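/- Let $H$ be a nonzero complex Hilbert space, let $B,C$ be bounded linear operators on $H$, and let $$w_e(B,C)=\sup\left\{\sqrt{|\langle Bx,x\rangle|^2+|\langle Cx,x\rangle|^2} : x\in H,\ \|x\|=1\right\}$$ be their Euclidean operator radius. Let $f:[0,\infty)\to[0,\infty)$ be increasing (that is, $f(a)\le f(b)$ whenever $0\le a\le b$) and operator convex on $H$, that is, $f$ is continuous and $$f((1-s)X+sY)\le(1-s)f(X)+sf(Y)$$ in the operator order, for all $s\in[0,1]$ and all self-adjoint bounded operators $X,Y$ on $H$ with spectra in $[0,\infty)$, where $f(X)$ is defined by the continuous functional calculus. Then the operator-valued function $t\mapsto f\big(t(B^*B+C^*C)+(1-t)(BB^*+CC^*)\big)$ is Bochner integrable on $[0,1]$ with respect to the operator norm, and $$f\big(w_e^2(B,C)\big)\le\left\|\int_0^1 f\big(t(B^*B+C^*C)+(1-t)(BB^*+CC^*)\big)\,dt\right\|\le\frac12\left\|f(B^*B+C^*C)+f(BB^*+CC^*)\right\|.$$ -/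

import Mathlib

open scoped InnerProduct

/-- The Euclidean operator radius `w_e(B, C)` of two bounded operators: the supremum of
`(|⟨Bx, x⟩|² + |⟨Cx, x⟩|²)^(1/2)` over the unit vectors `x`. -/
noncomputable def euclideanOperatorRadius {H : Type*} [NormedAddCommGroup H]
    [InnerProductSpace ℂ H] (B C : H →L[ℂ] H) : ℝ :=
  sSup {r : ℝ | ∃ x : H, ‖x‖ = 1 ∧
    r = Real.sqrt (‖inner ℂ (B x) x‖ ^ 2 + ‖inner ℂ (C x) x‖ ^ 2)}

/-- `f` is operator convex on `J`, for operators on the Hilbert space `H`: it is continuous on `J`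
and `f((1 - s)X + sY) ≤ (1 - s) f(X) + s f(Y)` in the Loewner order, for all `s ∈ [0, 1]` and all
self-adjoint operators `X`, `Y` on `H` with spectra in `J`.
Here `f(X)` is given by the continuous functional calculus. -/
def IsOperatorConvexOn (H : Type*) [NormedAddCommGroup H] [InnerProductSpace ℂ H]
    [CompleteSpace H] (J : Set ℝ) (f : ℝ → ℝ) : Prop :=
  ContinuousOn f J ∧
    ∀ X Y : H →L[ℂ] H, IsSelfAdjoint X → IsSelfAdjoint Y →
      spectrum ℝ X ⊆ J → spectrum ℝ Y ⊆ J →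
      ∀ s : ℝ, 0 ≤ s → s ≤ 1 →
        cfc f ((1 - s) • X + s • Y) ≤ (1 - s) • cfc f X + s • cfc f Y

/-! Write P = B*B + C*C and Q = BB* + CC*. For a unit vector x, Cauchy–Schwarz bounds |⟨Bx, x⟩|² +
|⟨Cx, x⟩|² by both ⟨Px, x⟩ and ⟨Qx, x⟩, hence by ⟨(tP + (1 - t)Q)x, x⟩. Monotonicity and Jensen
(`ConvexOn.map_quadraticFormCLM_le`) move f inside the form; integrating in t and bounding the form
by the norm gives the lower estimate. The upper estimate integrates the operator convexity
inequality over t and uses that the norm is monotone on positive operators. Integrability follows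
from norm continuity of the integrand. -/

/-- The quadratic form `T ↦ re ⟪x, T x⟫` at a vector `x`, as a continuous real-linear functional. -/
noncomputable def quadraticFormCLM {H : Type*} [NormedAddCommGroup H] [InnerProductSpace ℂ H]
    (x : H) : (H →L[ℂ] H) →L[ℝ] ℝ :=
  Complex.reCLM.comp
    (((innerSL ℂ x).comp (ContinuousLinearMap.apply ℂ H x)).restrictScalars ℝ)

section QuadraticForm

variable {H : Type*} [NormedAddCommGroup H] [InnerProductSpace ℂ H]

lemma quadraticFormCLM_apply (x : H) (T : H →L[ℂ] H) :
    quadraticFormCLM x T = (inner ℂ x (T x)).re := rfl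

lemma quadraticFormCLM_one {x : H} (hx : ‖x‖ = 1) :
    quadraticFormCLM x (1 : H →L[ℂ] H) = 1 := by
  rw [quadraticFormCLM_apply, one_apply_eq_self, inner_self_eq_norm_sq_to_K, hx]
  simp

lemma quadraticFormCLM_le_norm {x : H} (hx : ‖x‖ = 1) (T : H →L[ℂ] H) :
    quadraticFormCLM x T ≤ ‖T‖ := by
  rw [quadraticFormCLM_apply]
  calc (inner ℂ x (T x)).re ≤ ‖inner ℂ x (T x)‖ := Complex.re_le_norm _
    _ ≤ ‖x‖ * ‖T x‖ := norm_inner_le_norm _ _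
    _ ≤ ‖T‖ := by simpa [hx] using T.le_opNorm x

lemma quadraticFormCLM_mono (x : H) {S T : H →L[ℂ] H} (h : S ≤ T) :
    quadraticFormCLM x S ≤ quadraticFormCLM x T := by
  have := ((ContinuousLinearMap.le_def S T).1 h).re_inner_nonneg_right x
  rw [← sub_nonneg, ← map_sub]
  exact this

variable [CompleteSpace H]

lemma quadraticFormCLM_adjoint_mul_self (x : H) (T : H →L[ℂ] H) :
    quadraticFormCLM x (T† * T) = ‖T x‖ ^ 2 := by
  change (inner ℂ x ((T†) (T x))).re = _
  rw [ContinuousLinearMap.adjoint_inner_right, inner_self_eq_norm_sq_to_K]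
  norm_cast

lemma quadraticFormCLM_self_mul_adjoint (x : H) (T : H →L[ℂ] H) :
    quadraticFormCLM x (T * T†) = ‖(T†) x‖ ^ 2 := by
  simpa using quadraticFormCLM_adjoint_mul_self x (T†)

lemma norm_inner_sq_le_adjoint_mul_self {x : H} (hx : ‖x‖ = 1) (T : H →L[ℂ] H) :
    ‖inner ℂ (T x) x‖ ^ 2 ≤ quadraticFormCLM x (T† * T) := by
  rw [quadraticFormCLM_adjoint_mul_self]
  gcongr
  simpa [hx] using norm_inner_le_norm (𝕜 := ℂ) (T x) x

/-- Cauchy–Schwarz again, after moving T across the inner product. -/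
lemma norm_inner_sq_le_self_mul_adjoint {x : H} (hx : ‖x‖ = 1) (T : H →L[ℂ] H) :
    ‖inner ℂ (T x) x‖ ^ 2 ≤ quadraticFormCLM x (T * T†) := by
  rw [quadraticFormCLM_self_mul_adjoint, ← ContinuousLinearMap.adjoint_inner_right]
  gcongr
  simpa [hx] using norm_inner_le_norm (𝕜 := ℂ) x ((T†) x)

end QuadraticForm

/-- A convex monotone function on `[0, ∞)` has an affine support at every point. -/
lemma ConvexOn.exists_affine_support_of_monotoneOn_Ici {f : ℝ → ℝ}
    (hc : ConvexOn ℝ (Set.Ici 0) f) (hm : MonotoneOn f (Set.Ici 0)) {a : ℝ} (ha : 0 ≤ a) :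
    ∃ m : ℝ, ∀ y, 0 ≤ y → f a + m * (y - a) ≤ f y := by
  rcases ha.eq_or_lt with rfl | ha
  -- At the endpoint 0 a convex function may lack a support line; monotonicity supplies one of slope
  -- 0.
  · exact ⟨0, fun y hy => by simpa using hm (Set.mem_Ici.2 le_rfl) hy hy⟩
  have hai : a ∈ interior (Set.Ici (0 : ℝ)) := by simpa using ha
  refine ⟨derivWithin f (Set.Ioi a) a, fun y hy => ?_⟩
  rcases lt_trichotomy y a with h | rfl | h
  · have h1 := (hc.slope_le_leftDeriv_of_mem_interior hy hai h).trans
      (hc.leftDeriv_le_rightDeriv_of_mem_interior hai)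
    rw [slope_def_field, div_le_iff₀ (by linarith)] at h1
    linarith
  · simp
  · have h1 := hc.rightDeriv_le_slope_of_mem_interior hai hy h
    rw [slope_def_field, le_div_iff₀ (by linarith)] at h1
    linarith

section OperatorConvex

variable {H : Type*} [NormedAddCommGroup H] [InnerProductSpace ℂ H] [CompleteSpace H]

lemma spectrum_subset_Ici_of_nonneg {A : H →L[ℂ] H} (hA : 0 ≤ A) :
    spectrum ℝ A ⊆ Set.Ici 0 := fun _ hy => spectrum_nonneg_of_nonneg hA hy

/-- An operator convex function on `[0, ∞)` is convex. -/
lemma IsOperatorConvexOn.convexOn_Ici [Nontrivial H] {f : ℝ → ℝ}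
    (hf : IsOperatorConvexOn H (Set.Ici 0) f) : ConvexOn ℝ (Set.Ici 0) f := by
  refine ⟨convex_Ici 0, fun a ha b hb s t hs ht hst => ?_⟩
  obtain rfl : s = 1 - t := by linarith
  -- Scalar convexity is operator convexity for scalar operators, tested on a unit vector.
  obtain ⟨x, hx⟩ := exists_norm_eq H zero_le_one
  have key := hf.2 (algebraMap ℝ _ a) (algebraMap ℝ _ b) (.algebraMap _ (.all a))
    (.algebraMap _ (.all b)) (by simpa [spectrum.scalar_eq] using ha)
    (by simpa [spectrum.scalar_eq] using hb) t ht (by linarith)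
  rw [cfc_algebraMap, cfc_algebraMap, show (1 - t) • algebraMap ℝ (H →L[ℂ] H) a +
    t • algebraMap ℝ (H →L[ℂ] H) b = algebraMap ℝ _ ((1 - t) * a + t * b) by
      simp only [Algebra.algebraMap_eq_smul_one, smul_smul, ← add_smul], cfc_algebraMap] at key
  have := quadraticFormCLM_mono x key
  simpa [Algebra.algebraMap_eq_smul_one, quadraticFormCLM_one hx] using this

/-- Jensen's inequality for the quadratic form of a positive operator. -/
lemma ConvexOn.map_quadraticFormCLM_le {f : ℝ → ℝ} (hc : ConvexOn ℝ (Set.Ici 0) f)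
    (hm : MonotoneOn f (Set.Ici 0)) (hcont : ContinuousOn f (Set.Ici 0)) {A : H →L[ℂ] H}
    (hA : 0 ≤ A) {x : H} (hx : ‖x‖ = 1) :
    f (quadraticFormCLM x A) ≤ quadraticFormCLM x (cfc f A) := by
  have hsp := spectrum_subset_Ici_of_nonneg hA
  have hA' : IsSelfAdjoint A := .of_nonneg hA
  set a := quadraticFormCLM x A with ha_def
  have ha : 0 ≤ a := by simpa using quadraticFormCLM_mono x hA
  obtain ⟨m, hm⟩ := hc.exists_affine_support_of_monotoneOn_Ici hm ha
  -- The support line at a = ⟨Ax, x⟩ lies below f on the spectrum; its linear term vanishes when the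
  -- form is evaluated at x.
  have h1 : cfc (fun y => (f a - m * a) + m * y) A ≤ cfc f A :=
    cfc_mono (fun y hy => by linarith [hm y (hsp hy)]) (by fun_prop) (hcont.mono hsp)
  rw [cfc_const_add _ _ A, cfc_const_mul_id m A] at h1
  have h2 := quadraticFormCLM_mono x h1
  simp only [map_add, Algebra.algebraMap_eq_smul_one, map_smul, quadraticFormCLM_one hx,
    smul_eq_mul, ← ha_def] at h2
  linarith

/-- The continuous functional calculus is norm continuous on the segment joining two positive
operators. -/
lemma continuousOn_cfc_segment {f : ℝ → ℝ} (hf : ContinuousOn f (Set.Ici 0))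
    {P Q : H →L[ℂ] H} (hP : 0 ≤ P) (hQ : 0 ≤ Q) :
    ContinuousOn (fun t : ℝ => cfc f (t • P + (1 - t) • Q)) (Set.Icc 0 1) := by
  have hnn : ∀ t ∈ Set.Icc (0 : ℝ) 1, 0 ≤ t • P + (1 - t) • Q := fun t ht =>
    add_nonneg (smul_nonneg ht.1 hP) (smul_nonneg (by linarith [ht.2]) hQ)
  -- Continuity in the operator needs one compact set containing every spectrum along the segment.
  refine ContinuousOn.cfc' (s := Set.Icc 0 ((‖P‖ + ‖Q‖) * ‖(1 : H →L[ℂ] H)‖)) isCompact_Icc f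
    (by fun_prop) (fun t ht y hy => ?_) (fun t ht => .of_nonneg (hnn t ht)) (hf.mono fun y hy => hy.1)
  refine ⟨spectrum_nonneg_of_nonneg (hnn t ht) hy, ?_⟩
  refine (le_abs_self y).trans ((spectrum.norm_le_norm_mul_of_mem hy).trans ?_)
  gcongr
  refine (norm_add_le _ _).trans ?_
  rw [norm_smul, norm_smul, Real.norm_of_nonneg ht.1, Real.norm_of_nonneg (by linarith [ht.2])]
  nlinarith [norm_nonneg P, norm_nonneg Q, ht.1, ht.2]

/-- The Hermite–Hadamard upper bound for an operator convex function. -/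
lemma IsOperatorConvexOn.integral_cfc_segment_le {f : ℝ → ℝ}
    (hf : IsOperatorConvexOn H (Set.Ici 0) f) {P Q : H →L[ℂ] H} (hP : 0 ≤ P) (hQ : 0 ≤ Q) :
    ∫ t in (0 : ℝ)..1, cfc f (t • P + (1 - t) • Q) ≤ (1 / 2 : ℝ) • (cfc f P + cfc f Q) := by
  have hi := (continuousOn_cfc_segment hf.1 hP hQ).intervalIntegrable_of_Icc
    (μ := MeasureTheory.volume) zero_le_one
  have hg : ∫ t in (0 : ℝ)..1, ((1 - t) • cfc f Q + t • cfc f P) =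
      (1 / 2 : ℝ) • (cfc f P + cfc f Q) := by
    rw [intervalIntegral.integral_add, intervalIntegral.integral_smul_const,
      intervalIntegral.integral_smul_const]
    · have h1 : ∫ t in (0 : ℝ)..1, (1 - t) = 1 / 2 := by
        rw [intervalIntegral.integral_sub] <;> norm_num
      have h2 : ∫ t in (0 : ℝ)..1, t = 1 / 2 := by norm_num
      rw [h1, h2, smul_add, add_comm]
    all_goals exact Continuous.intervalIntegrable (by fun_prop) _ _
  rw [← hg, intervalIntegral.integral_of_le zero_le_one, intervalIntegral.integral_of_le zero_le_one]
  refine MeasureTheory.setIntegral_mono_on (hi.1)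
    (Continuous.intervalIntegrable (by fun_prop) 0 1).1 measurableSet_Ioc fun t ht => ?_
  rw [add_comm (t • P)]
  exact hf.2 Q P (.of_nonneg hQ) (.of_nonneg hP) (spectrum_subset_Ici_of_nonneg hQ)
    (spectrum_subset_Ici_of_nonneg hP) t ht.1.le ht.2

end OperatorConvex

/-- A bound on `f` at the squares `|⟨Bx, x⟩|² + |⟨Cx, x⟩|²` passes to their supremum. -/
lemma map_euclideanOperatorRadius_sq_le {H : Type*} [NormedAddCommGroup H]
    [InnerProductSpace ℂ H] [Nontrivial H] (B C : H →L[ℂ] H) {f : ℝ → ℝ}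
    (hf : ContinuousOn f (Set.Ici 0)) {M : ℝ}
    (h : ∀ x : H, ‖x‖ = 1 → f (‖inner ℂ (B x) x‖ ^ 2 + ‖inner ℂ (C x) x‖ ^ 2) ≤ M) :
    f (euclideanOperatorRadius B C ^ 2) ≤ M := by
  set S := {r : ℝ | ∃ x : H, ‖x‖ = 1 ∧
    r = Real.sqrt (‖inner ℂ (B x) x‖ ^ 2 + ‖inner ℂ (C x) x‖ ^ 2)} with hS
  have hne : S.Nonempty := by
    obtain ⟨x, hx⟩ := exists_norm_eq H zero_le_one
    exact ⟨_, x, hx, rfl⟩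
  have hin : ∀ (T : H →L[ℂ] H) (x : H), ‖x‖ = 1 → ‖inner ℂ (T x) x‖ ≤ ‖T‖ := fun T x hx =>
    (norm_inner_le_norm _ _).trans (by simpa [hx] using T.le_opNorm x)
  have hbdd : BddAbove S := by
    refine ⟨Real.sqrt (‖B‖ ^ 2 + ‖C‖ ^ 2), ?_⟩
    rintro _ ⟨x, hx, rfl⟩
    gcongr
    · exact hin B x hx
    · exact hin C x hx
  -- The bound holds on a closed set of radii, so it passes to the supremum, a limit of elements of
  -- `S`.
  have hcl : IsClosed (Set.Ici (0 : ℝ) ∩ (fun r => f (r ^ 2)) ⁻¹' Set.Iic M) :=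
    (hf.comp (by fun_prop) fun r _ => sq_nonneg r).preimage_isClosed_of_isClosed
      isClosed_Ici isClosed_Iic
  have hsub : S ⊆ Set.Ici (0 : ℝ) ∩ (fun r => f (r ^ 2)) ⁻¹' Set.Iic M := by
    rintro _ ⟨x, hx, rfl⟩
    refine ⟨Real.sqrt_nonneg _, ?_⟩
    rw [Set.mem_preimage, Real.sq_sqrt (by positivity)]
    exact h x hx
  exact (hcl.closure_subset_iff.2 hsub (csSup_mem_closure hne hbdd)).2

theorem theorem2p10 {H : Type*} [NormedAddCommGroup H] [InnerProductSpace ℂ H]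
    [CompleteSpace H] [Nontrivial H] (B C : H →L[ℂ] H) (f : ℝ → ℝ)
    (hf_maps : Set.MapsTo f (Set.Ici 0) (Set.Ici 0))
    (hf_mono : MonotoneOn f (Set.Ici 0))
    (hf_conv : IsOperatorConvexOn H (Set.Ici 0) f) :
    IntervalIntegrable
      (fun t : ℝ => cfc f (t • (B† * B + C† * C) + (1 - t) • (B * B† + C * C†)))
      MeasureTheory.volume 0 1 ∧
    f (euclideanOperatorRadius B C ^ 2) ≤
      ‖∫ t in (0 : ℝ)..1, cfc f (t • (B† * B + C† * C) + (1 - t) • (B * B† + C * C†))‖ ∧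
    ‖∫ t in (0 : ℝ)..1, cfc f (t • (B† * B + C† * C) + (1 - t) • (B * B† + C * C†))‖ ≤
      1 / 2 * ‖cfc f (B† * B + C† * C) + cfc f (B * B† + C * C†)‖ := by
  have hP : 0 ≤ B† * B + C† * C := add_nonneg (star_mul_self_nonneg B) (star_mul_self_nonneg C)
  have hQ : 0 ≤ B * B† + C * C† := add_nonneg (mul_star_self_nonneg B) (mul_star_self_nonneg C)
  have hPx : ∀ x : H, ‖x‖ = 1 → ‖inner ℂ (B x) x‖ ^ 2 + ‖inner ℂ (C x) x‖ ^ 2 ≤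
      quadraticFormCLM x (B† * B + C† * C) := fun x hx => by
    rw [map_add]
    exact add_le_add (norm_inner_sq_le_adjoint_mul_self hx B)
      (norm_inner_sq_le_adjoint_mul_self hx C)
  have hQx : ∀ x : H, ‖x‖ = 1 → ‖inner ℂ (B x) x‖ ^ 2 + ‖inner ℂ (C x) x‖ ^ 2 ≤
      quadraticFormCLM x (B * B† + C * C†) := fun x hx => by
    rw [map_add]
    exact add_le_add (norm_inner_sq_le_self_mul_adjoint hx B)
      (norm_inner_sq_le_self_mul_adjoint hx C)
  -- From here only positivity and the two form bounds matter.
  generalize B† * B + C† * C = P at *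
  generalize B * B† + C * C† = Q at *
  have hi := (continuousOn_cfc_segment hf_conv.1 hP hQ).intervalIntegrable_of_Icc
    (μ := MeasureTheory.volume) zero_le_one
  have hnn : ∀ t ∈ Set.Icc (0 : ℝ) 1, 0 ≤ t • P + (1 - t) • Q := fun t ht =>
    add_nonneg (smul_nonneg ht.1 hP) (smul_nonneg (by linarith [ht.2]) hQ)
  refine ⟨hi, map_euclideanOperatorRadius_sq_le B C hf_conv.1 fun x hx => ?_, ?_⟩
  · refine le_trans ?_ (quadraticFormCLM_le_norm hx _)
    rw [← (quadraticFormCLM x).intervalIntegral_comp_comm hi]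
    have hc : ∀ c : ℝ, ∫ _ in (0 : ℝ)..1, c = c := fun c => by simp
    rw [← hc (f _)]
    refine intervalIntegral.integral_mono_on zero_le_one (by simp)
      ((quadraticFormCLM x).continuous.comp_continuousOn
        (continuousOn_cfc_segment hf_conv.1 hP hQ) |>.intervalIntegrable_of_Icc zero_le_one)
      fun t ht => le_trans ?_
        (hf_conv.convexOn_Ici.map_quadraticFormCLM_le hf_mono hf_conv.1 (hnn t ht) hx)
    have h0 : 0 ≤ ‖inner ℂ (B x) x‖ ^ 2 + ‖inner ℂ (C x) x‖ ^ 2 := by positivity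
    have hle : ‖inner ℂ (B x) x‖ ^ 2 + ‖inner ℂ (C x) x‖ ^ 2 ≤
        quadraticFormCLM x (t • P + (1 - t) • Q) := by
      rw [map_add, map_smul, map_smul, smul_eq_mul, smul_eq_mul]
      nlinarith [hPx x hx, hQx x hx, ht.1, ht.2]
    exact hf_mono h0 (h0.trans hle) hle
  -- Norm monotonicity requires a positive smaller operator; this is where f ≥ 0 enters.
  · have hint : 0 ≤ ∫ t in (0 : ℝ)..1, cfc f (t • P + (1 - t) • Q) := by
      rw [intervalIntegral.integral_of_le zero_le_one]
      refine MeasureTheory.integral_nonneg_of_ae ?_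
      filter_upwards [MeasureTheory.ae_restrict_mem measurableSet_Ioc] with t ht
      exact cfc_nonneg fun y hy =>
        hf_maps (spectrum_subset_Ici_of_nonneg (hnn t ⟨ht.1.le, ht.2⟩) hy)
    have := CStarAlgebra.norm_le_norm_of_nonneg_of_le hint
      (hf_conv.integral_cfc_segment_le hP hQ)
    rwa [norm_smul, Real.norm_of_nonneg (by norm_num)] at this
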